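/- **Theorem.** All quantum systems have finite but arbitrary dimension. Consider one round of a DIQKD protocol: a state $\rho_{ABE}$ of Alice, Bob and Eve (for instance pure, or with a public symmetrisation bit included in $A$, $B$ and $E$) and binary-outcome measurements (POVMs) $A_0$ on $A$ and $B_0$ on $B$. Let $\Pr(a,b)$ be the probability of the outcome $(a,b)\in\{0,1\}^2$ of $(A_0,B_0)$ and $\rho_{E|ab}$ Eve's state conditioned on that outcome. Assume that the outcomes are symmetrised with error rate $\varepsilon<1/2$, i.e. $\Pr(0,1)=\Pr(1,0)=\varepsilon/2$ and $\Pr(0,0)=\Pr(1,1)=(1-\varepsilon)/2$. Consider the repetition-code advantage-distillation protocol with block length $n$ under collective attacks: in $n$ independent and identically distributed rounds $A_0$ and $B_0$ are measured, giving strings $\mathbf A_0,\mathbf B_0\in\{0,1\}^n$ and leaving Eve with the systems $\mathbf E=E^n$. Alice draws a private uniform bit $C$ and announces $\mathbf M=\mathbf A_0\oplus(C,\dots,C)$. Bob accepts ($D=1$) if and only if $\mathbf B_0\oplus\mathbf M=(C',\dots,C')$ for some bit $C'$. Let $$ r_n = H(C|\mathbf E\mathbf M;D=1)-H(C|C';D=1),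 $$ where $H(X|Y;D=1)=H(XY)-H(Y)$ is the conditional von Neumann entropy of the state conditioned on $D=1$. With the root-fidelity $F(\rho,\sigma)=\|\sqrt\rho\sqrt\sigma\|_1$, if $$ F(\rho_{E|00},\rho_{E|11})^2>\frac{\varepsilon}{1-\varepsilon}, $$ then $r_n>0$ for all sufficiently large $n$. -/

import Mathlib

open scoped Kronecker ComplexOrder

noncomputable section

namespace RepetitionCode

/-! ### Finite-dimensional quantum information

A system with index type `d` is the Hilbert space `ℂ ^ d`, its operators are the matrices
`Matrix d d ℂ`, and functions of Hermitian operators are taken in the continuous functional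
calculus. -/

/-- A density operator: positive semidefinite and of unit trace. -/
structure IsDensity {d : Type*} [Fintype d] (ρ : Matrix d d ℂ) : Prop where
  posSemidef : ρ.PosSemidef
  trace_eq_one : ρ.trace = 1

/-- A measurement (POVM) with outcomes in `o` on the system `d`. -/
structure POVM (d o : Type*) [Fintype d] [DecidableEq d] [Fintype o] where
  effect : o → Matrix d d ℂ
  posSemidef : ∀ k, (effect k).PosSemidef
  sum_eq_one : ∑ k, effect k = 1

/-- The trace norm `‖T‖₁ = tr √(T† T)`. -/
def traceNorm {d : Type*} [Fintype d] [DecidableEq d] (T : Matrix d d ℂ) : ℝ :=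
  (cfc Real.sqrt (T.conjTranspose * T)).trace.re

/-- The root-fidelity `F(ρ, σ) = ‖√ρ √σ‖₁`. -/
def rootFidelity {d : Type*} [Fintype d] [DecidableEq d] (ρ σ : Matrix d d ℂ) : ℝ :=
  traceNorm (cfc Real.sqrt ρ * cfc Real.sqrt σ)

/-- The von Neumann entropy `- tr (ρ log₂ ρ)`, in bits. -/
def vonNeumannEntropy {d : Type*} [Fintype d] [DecidableEq d] (ρ : Matrix d d ℂ) : ℝ :=
  (cfc Real.negMulLog ρ).trace.re / Real.log 2

/-- The von Neumann entropy of a classical register, that is, the Shannon entropy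
`- ∑ k, p k log₂ (p k)` of its distribution, in bits. -/
def shannonEntropy {o : Type*} [Fintype o] (p : o → ℝ) : ℝ :=
  (∑ k, Real.negMulLog (p k)) / Real.log 2

/-! ### One round -/

/-- A single round in which the key-generating measurements are made: the Alice-Bob-Eve state and
the binary measurements `A₀`, `B₀` of the devices. The state is arbitrary, so it may in particular
be pure (Eve holding a purification), and Eve's system may contain classical public data, such as
the bit that was used to symmetrise the outcomes. -/
structure Round (dA dB dE : Type*) [Fintype dA] [DecidableEq dA] [Fintype dB] [DecidableEq dB]
    [Fintype dE] [DecidableEq dE] where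
  /-- the state of Alice, Bob and Eve -/
  state : Matrix (dA × dB × dE) (dA × dB × dE) ℂ
  isDensity : IsDensity state
  /-- the key-generating measurement of Alice -/
  A₀ : POVM dA Bool
  /-- the key-generating measurement of Bob -/
  B₀ : POVM dB Bool

namespace Round

variable {dA dB dE : Type*} [Fintype dA] [DecidableEq dA] [Fintype dB] [DecidableEq dB]
  [Fintype dE] [DecidableEq dE] (R : Round dA dB dE)

/-- Eve's subnormalised state `tr_AB ((A₀(a) ⊗ B₀(b) ⊗ 1) ρ_ABE)` on the outcome `(a, b)`; its
trace is the probability of that outcome. -/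
def eveOp (a b : Bool) : Matrix dE dE ℂ :=
  Matrix.of fun e e' => ∑ i : dA, ∑ j : dB,
    ((R.A₀.effect a ⊗ₖ (R.B₀.effect b ⊗ₖ (1 : Matrix dE dE ℂ))) * R.state) (i, j, e) (i, j, e')

/-- The probability of the outcome `(a, b)` of `(A₀, B₀)`. -/
def prob (a b : Bool) : ℝ := (R.eveOp a b).trace.re

/-- Eve's state `ρ_{E|ab}` conditioned on the outcome `(a, b)` of `(A₀, B₀)`. -/
def eveState (a b : Bool) : Matrix dE dE ℂ := ((R.prob a b)⁻¹ : ℂ) • R.eveOp a b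

/-- The outcomes of `A₀`, `B₀` are symmetrised, with error rate `ε`. -/
structure Symmetrised (ε : ℝ) : Prop where
  prob_ff : R.prob false false = (1 - ε) / 2
  prob_tt : R.prob true true = (1 - ε) / 2
  prob_ft : R.prob false true = ε / 2
  prob_tf : R.prob true false = ε / 2

/-! ### A block of `n` independent and identically distributed rounds -/

/-- Eve's subnormalised state on all `n` rounds, when the output strings are `a` and `b`: the
tensor product of the states of the rounds. -/
def eveBlock {n : ℕ} (a b : Fin n → Bool) : Matrix (Fin n → dE) (Fin n → dE) ℂ :=
  Matrix.of fun x y => ∏ i, R.eveOp (a i) (b i) (x i) (y i)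

/-- Eve's subnormalised state on the event that Alice's uniform bit is `C = c`, her message is
`M = A₀ ⊕ (C, …, C) = m`, and Bob accepts (`D = 1`) with `B₀ ⊕ M = (C', …, C')` for `C' = c'`. -/
def acceptedOp {n : ℕ} (c c' : Bool) (m : Fin n → Bool) :
    Matrix (Fin n → dE) (Fin n → dE) ℂ :=
  ∑ a : Fin n → Bool, ∑ b : Fin n → Bool,
    if (∀ i, m i = xor (a i) c) ∧ (∀ i, xor (b i) (m i) = c') then
      (1 / 2 : ℂ) • R.eveBlock a b
    else 0

/-- The probability that Bob accepts the block, `Pr[D = 1]`. -/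
def acceptProb (n : ℕ) : ℝ :=
  ∑ c : Bool, ∑ c' : Bool, ∑ m : Fin n → Bool, (R.acceptedOp c c' m).trace.re

/-- The state of `C C' M E` conditioned on `D = 1`, where `C`, `C'`, `M` are classical: its
component at `C = c`, `C' = c'`, `M = m`, an operator on Eve's `n` systems. -/
def condOp {n : ℕ} (c c' : Bool) (m : Fin n → Bool) :
    Matrix (Fin n → dE) (Fin n → dE) ℂ :=
  ((R.acceptProb n)⁻¹ : ℂ) • R.acceptedOp c c' m

/-- The state of `C M E` conditioned on `D = 1`. -/
def stateCME (n : ℕ) :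
    Matrix ((Fin n → dE) × (Bool × (Fin n → Bool))) ((Fin n → dE) × (Bool × (Fin n → Bool))) ℂ :=
  Matrix.blockDiagonal fun k => ∑ c' : Bool, R.condOp k.1 c' k.2

/-- The state of `M E` conditioned on `D = 1`. -/
def stateME (n : ℕ) : Matrix ((Fin n → dE) × (Fin n → Bool)) ((Fin n → dE) × (Fin n → Bool)) ℂ :=
  Matrix.blockDiagonal fun m => ∑ c : Bool, ∑ c' : Bool, R.condOp c c' m

/-- The joint distribution of `(C, C')` conditioned on `D = 1`. -/
def probCC (n : ℕ) (k : Bool × Bool) : ℝ := ∑ m : Fin n → Bool, (R.condOp k.1 k.2 m).trace.re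

/-- `H(C | E M; D = 1) = H(C E M; D = 1) - H(E M; D = 1)`. -/
def entropyEve (n : ℕ) : ℝ := vonNeumannEntropy (R.stateCME n) - vonNeumannEntropy (R.stateME n)

/-- `H(C | C'; D = 1) = H(C C'; D = 1) - H(C'; D = 1)`. -/
def entropyBob (n : ℕ) : ℝ :=
  shannonEntropy (R.probCC n) - shannonEntropy fun c' : Bool => ∑ c : Bool, R.probCC n (c, c')

/-- The key-rate quantity `r = H(C | E M; D = 1) - H(C | C'; D = 1)` of a block of `n` rounds. -/
def keyRate (n : ℕ) : ℝ := R.entropyEve n - R.entropyBob n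

end Round

end RepetitionCode

end

/-! Given the message and C' = C, Eve has to distinguish two product states whose factors are
ρ_{E|00} and ρ_{E|11}, exchanged wherever the message bit is 1. Her error probability is at least a
constant times F^(2n). Bob's is at most x^n with x = ε/(1-ε), so his entropy is at most of order n
x^n. For x < F^2 the first dominates, since n (x/F^2)^n tends to 0.

Eve's side rests on two bounds. `error_le_entropy`: for weighted hypotheses A and B, the operator S
= A + (B-A)₊ dominates both; operator monotonicity of log and Klein's inequality then bound the
conditional entropy, in nats, below by tr (A+B) - tr S, the error of the optimal test.
`norm_trace_sq_le_error`: by Cauchy-Schwarz that error, for normalised states, is at least half the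
squared overlap of any purifications. Overlaps multiply under tensor products, so purifications
attaining F in one round yield F^(2n) for the block (`le_entropy_block`).

On Bob's side `binEntropy_odds_le` bounds the binary entropy at odds x^n, and
`eventually_pow_mul_lt` compares the rates. -/

namespace RepetitionCode

/-! ### Trace inequalities from spectral decompositions -/

section Spectral

variable {d : Type*} [Fintype d] [DecidableEq d]

open Matrix

/-- The spectrum is finite, so step functions and pseudo-inverses are admissible in the functional
calculus. -/
lemma continuousOn_spectrum (A : Matrix d d ℂ) (f : ℝ → ℝ) : ContinuousOn f (spectrum ℝ A) :=
  Set.Finite.continuousOn (Matrix.finite_real_spectrum) f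

/-- The weights are squared overlaps of eigenvectors. Being nonnegative, they reduce trace
inequalities for two noncommuting operators to scalar ones in pairs of eigenvalues. -/
lemma trace_cfc_mul_cfc {X Y : Matrix d d ℂ} (hX : X.IsHermitian) (hY : Y.IsHermitian)
    (f g : ℝ → ℝ) :
    (cfc f X * cfc g Y).trace = ∑ i, ∑ j,
      ((‖((star (hX.eigenvectorUnitary : Matrix d d ℂ)) * hY.eigenvectorUnitary) i j‖ ^ 2 *
        (f (hX.eigenvalues i) * g (hY.eigenvalues j)) : ℝ) : ℂ) := by
  rw [hX.cfc_eq, hY.cfc_eq, IsHermitian.cfc, IsHermitian.cfc, Unitary.conjStarAlgAut_apply,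
    Unitary.conjStarAlgAut_apply]
  set U : Matrix d d ℂ := (hX.eigenvectorUnitary : Matrix d d ℂ)
  set V : Matrix d d ℂ := (hY.eigenvectorUnitary : Matrix d d ℂ)
  have h : ∀ D E : Matrix d d ℂ, (U * D * star U * (V * E * star V)).trace
      = (D * ((star U * V) * (E * star (star U * V)))).trace := by
    intro D E
    rw [star_mul, star_star]
    simp only [Matrix.mul_assoc]
    rw [Matrix.trace_mul_comm]
    simp only [Matrix.mul_assoc]
  rw [h]
  simp only [trace, diag_apply, diagonal_mul, mul_apply (M := star U * V)]
  refine Finset.sum_congr rfl fun i _ => ?_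
  rw [Finset.mul_sum]
  refine Finset.sum_congr rfl fun j _ => ?_
  rw [star_apply, Complex.ofReal_mul, Complex.ofReal_pow, ← Complex.mul_conj']
  simp
  ring

lemma trace_cfc {X : Matrix d d ℂ} (hX : X.IsHermitian) (f : ℝ → ℝ) :
    (cfc f X).trace = ∑ i, (f (hX.eigenvalues i) : ℂ) := by
  rw [hX.cfc_eq, IsHermitian.cfc, Unitary.conjStarAlgAut_apply, trace_mul_comm, ← mul_assoc]
  simp [trace]

/-- Klein's inequality. -/
lemma klein {X Y : Matrix d d ℂ} (hX : X.PosDef) (hY : Y.PosDef) :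
    X.trace.re - Y.trace.re ≤
      (cfc (fun x : ℝ => x * Real.log x) X).trace.re - (X * cfc Real.log Y).trace.re := by
  -- Inserting the constant function 1 of the other operator puts all four traces into double sums
  -- with the same weights.
  have h1 : ∀ f : ℝ → ℝ, cfc f X = cfc f X * cfc (fun _ => (1 : ℝ)) Y := fun f => by
    rw [cfc_const_one ℝ Y hY.1.isSelfAdjoint, mul_one]
  have h2 : Y = cfc (fun _ => (1 : ℝ)) X * cfc (fun x : ℝ => x) Y := by
    rw [cfc_const_one ℝ X hX.1.isSelfAdjoint, one_mul, cfc_id' ℝ Y hY.1.isSelfAdjoint]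
  have h3 : X = cfc (fun x : ℝ => x) X := (cfc_id' ℝ X hX.1.isSelfAdjoint).symm
  have e1 : X.trace = (cfc (fun x : ℝ => x) X * cfc (fun _ => (1 : ℝ)) Y).trace := by
    rw [← h1, ← h3]
  have e2 : (X * cfc Real.log Y).trace = (cfc (fun x : ℝ => x) X * cfc Real.log Y).trace := by
    rw [← h3]
  have e3 : Y.trace = (cfc (fun _ => (1 : ℝ)) X * cfc (fun x : ℝ => x) Y).trace := by rw [← h2]
  rw [e1, e2, e3, h1 (fun x : ℝ => x * Real.log x)]
  simp only [trace_cfc_mul_cfc hX.1 hY.1, ← Complex.ofReal_sum, Complex.ofReal_re,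
    ← Finset.sum_sub_distrib]
  refine Finset.sum_le_sum fun i _ => Finset.sum_le_sum fun j _ => ?_
  rw [← mul_sub, ← mul_sub]
  refine mul_le_mul_of_nonneg_left ?_ (by positivity)
  have hp := hX.eigenvalues_pos i
  have hq := hY.eigenvalues_pos j
  -- The scalar inequality p - q ≤ p log p - p log q is log t ≤ t - 1 at t = q/p, multiplied by p.
  have := Real.log_le_sub_one_of_pos (div_pos hq hp)
  rw [Real.log_div hq.ne' hp.ne'] at this
  have := mul_le_mul_of_nonneg_left this hp.le
  have e : hX.1.eigenvalues i * (hY.1.eigenvalues j / hX.1.eigenvalues i - 1)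
    = hY.1.eigenvalues j - hX.1.eigenvalues i := by field_simp
  nlinarith

lemma trace_mul_re_nonneg {A B : Matrix d d ℂ} (hA : A.PosSemidef) (hB : B.PosSemidef) :
    0 ≤ (A * B).trace.re := by
  obtain ⟨C, rfl⟩ : ∃ C : Matrix d d ℂ, B = C * Cᴴ := by
    open scoped MatrixOrder in
    obtain ⟨C, hC⟩ := CStarAlgebra.nonneg_iff_eq_mul_star_self.mp hB.nonneg
    exact ⟨C, hC⟩
  rw [← mul_assoc, trace_mul_comm, ← mul_assoc]
  exact (Complex.nonneg_iff.mp (hA.conjTranspose_mul_mul_same C).trace_nonneg).1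

lemma trace_mul_log_le {A S : Matrix d d ℂ} (hA : A.PosDef) (h : (S - A).PosSemidef) :
    (cfc (fun x : ℝ => x * Real.log x) A).trace.re ≤ (A * cfc Real.log S).trace.re := by
  have e : cfc (fun x : ℝ => x * Real.log x) A = A * cfc Real.log A := by
    rw [cfc_mul (fun x : ℝ => x) Real.log A (continuousOn_spectrum _ _) (continuousOn_spectrum _ _),
      cfc_id' ℝ A hA.1.isSelfAdjoint]
  have hlog : (cfc Real.log S - cfc Real.log A).PosSemidef := by
    open scoped MatrixOrder Matrix.Norms.L2Operator in
    exact CFC.log_le_log (a := A) (b := S) h (Matrix.isStrictlyPositive_iff_posDef.mpr hA)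
  have := trace_mul_re_nonneg hA.posSemidef hlog
  rw [mul_sub, trace_sub, Complex.sub_re] at this
  rw [e]
  linarith

end Spectral

/-! ### Conditional entropy against the error of the optimal test -/

section Holevo

variable {d : Type*} [Fintype d] [DecidableEq d]

open Matrix

lemma posSemidef_cfc {A : Matrix d d ℂ} {f : ℝ → ℝ} (hf : ∀ x, 0 ≤ f x) :
    (cfc f A).PosSemidef := by
  open scoped MatrixOrder in
  exact Matrix.nonneg_iff_posSemidef.mp (cfc_nonneg fun x _ => hf x)

/-- The natural-logarithm entropy functional `- tr (X log X)`. -/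
noncomputable def entropyNat (X : Matrix d d ℂ) : ℝ := (cfc Real.negMulLog X).trace.re

lemma trace_cfc_mul_log_eq (X : Matrix d d ℂ) :
    (cfc (fun x : ℝ => x * Real.log x) X).trace.re = - entropyNat X := by
  have : (fun x : ℝ => x * Real.log x) = fun x => - Real.negMulLog x := by
    funext x; simp [Real.negMulLog]
  rw [this, cfc_neg, entropyNat]; simp

lemma entropyNat_add_smul {X : Matrix d d ℂ} (hX : X.IsHermitian) (t : ℝ) :
    entropyNat (X + (t : ℂ) • 1) = ∑ i, Real.negMulLog (hX.eigenvalues i + t) := by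
  have h : X + (t : ℂ) • 1 = cfc (fun x : ℝ => x + t) X := by
    rw [cfc_add_const t (fun x : ℝ => x) X (continuousOn_spectrum _ _) hX.isSelfAdjoint,
      cfc_id' ℝ X hX.isSelfAdjoint, Algebra.algebraMap_eq_smul_one]
    simp
  rw [h, entropyNat, ← cfc_comp' Real.negMulLog (fun x : ℝ => x + t) X
    (Set.Finite.continuousOn (Set.Finite.image _ Matrix.finite_real_spectrum) _)
    (continuousOn_spectrum _ _) hX.isSelfAdjoint, trace_cfc hX]
  simp

lemma continuous_entropyNat_add_smul {X : Matrix d d ℂ} (hX : X.IsHermitian) :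
    Continuous fun t : ℝ => entropyNat (X + (t : ℂ) • 1) := by
  simp only [entropyNat_add_smul hX]
  exact continuous_finsetSum _ fun i _ =>
    Real.continuous_negMulLog.comp (continuous_const.add continuous_id)

/-- The spectral projection of `D` onto its positive part. -/
noncomputable def posProj (D : Matrix d d ℂ) : Matrix d d ℂ := cfc (fun x : ℝ => if 0 < x then 1 else 0) D

lemma posSemidef_posProj (D : Matrix d d ℂ) : (posProj D).PosSemidef :=
  posSemidef_cfc fun x => by split_ifs <;> simp

lemma posProj_mul_self (D : Matrix d d ℂ) : posProj D * posProj D = posProj D := by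
  rw [posProj, ← cfc_mul _ _ D (continuousOn_spectrum _ _) (continuousOn_spectrum _ _)]
  congr 1; funext x; split_ifs <;> simp

/-- For the two weighted hypotheses `A` and `B`, the entropy of the hypothesis given the system is
at least the error probability of the optimal test. -/
lemma error_le_entropy_of_posDef {A B : Matrix d d ℂ} (hA : A.PosDef) (hB : B.PosDef) :
    (A * posProj (B - A)).trace.re + (B * (1 - posProj (B - A))).trace.re ≤
      entropyNat A + entropyNat B - entropyNat (A + B) := by
  set D := B - A with hD
  have hDs : IsSelfAdjoint D := (hB.1.sub hA.1).isSelfAdjoint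
  have hDp : (D * posProj D) = cfc (fun x : ℝ => max x 0) D := by
    nth_rw 1 [← cfc_id' ℝ D hDs]
    rw [posProj, ← cfc_mul _ _ D (continuousOn_spectrum _ _) (continuousOn_spectrum _ _)]
    congr 1; funext x; split_ifs with h
    · simp [h.le]
    · simp [not_lt.mp h]
  have hDm : D * posProj D - D = cfc (fun x : ℝ => max x 0 - x) D := by
    rw [hDp, cfc_sub _ _ D (continuousOn_spectrum _ _) (continuousOn_spectrum _ _),
      cfc_id' ℝ D hDs]
  have hp : (D * posProj D).PosSemidef := hDp ▸ posSemidef_cfc fun x => le_max_right _ _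
  have hm : (D * posProj D - D).PosSemidef :=
    hDm ▸ posSemidef_cfc fun x => sub_nonneg.mpr (le_max_left _ _)
  -- S = A + D₊ = B + D₋ is a common upper bound of A and B, and the error of the test is exactly tr
  -- (A+B) - tr S.
  set S := A + D * posProj D with hS
  have hSpos : S.PosDef := hA.add_posSemidef hp
  have h1 := trace_mul_log_le (S := S) hA (by rw [hS, add_sub_cancel_left]; exact hp)
  have h2 := trace_mul_log_le (S := S) hB (by
    have : S - B = D * posProj D - D := by rw [hS, hD]; abel
    rw [this]; exact hm)
  have h3 := klein (hA.add hB) hSpos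
  rw [trace_cfc_mul_log_eq] at h1 h2 h3
  have e : A * posProj D + B * (1 - posProj D) = (A + B) - S := by
    rw [hS, hD]; noncomm_ring
  have e' := congrArg (fun M => M.trace.re) e
  simp only [trace_add, trace_sub, Complex.add_re, Complex.sub_re, add_mul] at e' h3
  linarith

lemma error_le_entropy {A B : Matrix d d ℂ} (hA : A.PosSemidef) (hB : B.PosSemidef) :
    (A * posProj (B - A)).trace.re + (B * (1 - posProj (B - A))).trace.re ≤
      entropyNat A + entropyNat B - entropyNat (A + B) := by
  -- Adding t to both operators makes them positive definite and leaves B - A, hence the test,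
  -- unchanged. Both sides are continuous in t, so t can tend to 0.
  have key : ∀ t : ℝ, 0 < t →
      ((A + (t : ℂ) • 1) * posProj (B - A)).trace.re
        + ((B + (t : ℂ) • 1) * (1 - posProj (B - A))).trace.re ≤
      entropyNat (A + (t : ℂ) • 1) + entropyNat (B + (t : ℂ) • 1)
        - entropyNat (A + B + ((2 * t : ℝ) : ℂ) • 1) := by
    intro t ht
    have h1 : ((t : ℂ) • (1 : Matrix d d ℂ)).PosDef :=
      Matrix.PosDef.one.smul (by exact_mod_cast ht)
    have := error_le_entropy_of_posDef (h1.posSemidef_add hA) (h1.posSemidef_add hB)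
    rw [add_sub_add_right_eq_sub] at this
    convert this using 3
    push_cast
    rw [two_mul, add_smul]; abel
  have hl : Continuous fun t : ℝ => ((A + (t : ℂ) • 1) * posProj (B - A)).trace.re
        + ((B + (t : ℂ) • 1) * (1 - posProj (B - A))).trace.re := by
    simp only [add_mul, smul_mul_assoc, one_mul, trace_add, trace_smul, Complex.add_re, smul_eq_mul,
      Complex.re_ofReal_mul]
    fun_prop
  have hr : Continuous fun t : ℝ => entropyNat (A + (t : ℂ) • 1) + entropyNat (B + (t : ℂ) • 1)
        - entropyNat (A + B + ((2 * t : ℝ) : ℂ) • 1) :=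
    ((continuous_entropyNat_add_smul hA.1).add (continuous_entropyNat_add_smul hB.1)).sub
      ((continuous_entropyNat_add_smul (hA.1.add hB.1)).comp (continuous_const.mul continuous_id))
  have := le_of_tendsto_of_tendsto (b := nhdsWithin (0 : ℝ) (Set.Ioi 0))
    (hl.continuousAt.tendsto.mono_left nhdsWithin_le_nhds)
    (hr.continuousAt.tendsto.mono_left nhdsWithin_le_nhds)
    (Filter.eventually_of_mem self_mem_nhdsWithin key)
  simpa using this

end Holevo

/-! ### Fidelity, purifications and projective tests -/

section Fidelity

open Matrix

variable {d k : Type*} [Fintype d] [DecidableEq d] [Fintype k]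

omit [DecidableEq d] in
lemma norm_trace_conjTranspose_mul_sq_le (X Y : Matrix d k ℂ) :
    ‖(Xᴴ * Y).trace‖ ^ 2 ≤ (X * Xᴴ).trace.re * (Y * Yᴴ).trace.re := by
  have h1 : ∀ X Y : Matrix d k ℂ, (Xᴴ * Y).trace = inner ℂ
      (WithLp.toLp 2 fun p => X p.2 p.1 : EuclideanSpace ℂ (k × d))
      (WithLp.toLp 2 fun p => Y p.2 p.1 : EuclideanSpace ℂ (k × d)) := by
    intro X Y
    simp [trace, mul_apply, PiLp.inner_apply, Fintype.sum_prod_type, mul_comm]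
  have h2 : ∀ X : Matrix d k ℂ, (X * Xᴴ).trace.re =
      ‖(WithLp.toLp 2 fun p => X p.2 p.1 : EuclideanSpace ℂ (k × d))‖ ^ 2 := by
    intro X
    rw [trace_mul_comm, h1, inner_self_eq_norm_sq_to_K]
    norm_cast
  rw [h1, h2, h2, ← mul_pow]
  exact pow_le_pow_left₀ (norm_nonneg _) (norm_inner_le_norm _ _) 2

/-- Overlaps of purifications bound the error probability of every projective test. -/
lemma norm_trace_sq_le_error {V W : Matrix d k ℂ} {P : Matrix d d ℂ} (hP : P.IsHermitian)
    (hPP : P * P = P) (hV : (V * Vᴴ).trace = 1) (hW : (W * Wᴴ).trace = 1) :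
    ‖(Vᴴ * W).trace‖ ^ 2 ≤ 2 * ((V * Vᴴ * P).trace.re + (W * Wᴴ * (1 - P)).trace.re) := by
  have hQ : (1 - P).IsHermitian := isHermitian_one.sub hP
  have hQQ : (1 - P) * (1 - P) = 1 - P := by
    rw [mul_sub, sub_mul, sub_mul, hPP]; simp
  have e : ∀ (Q : Matrix d d ℂ) (X : Matrix d k ℂ), Q.IsHermitian → Q * Q = Q →
      ((Q * X) * (Q * X)ᴴ).trace.re = (X * Xᴴ * Q).trace.re := by
    intro Q X hQ hQQ
    rw [conjTranspose_mul, hQ.eq, trace_mul_comm, Matrix.mul_assoc Xᴴ, ← Matrix.mul_assoc Q, hQQ,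
      trace_mul_comm, Matrix.mul_assoc, trace_mul_comm]
  have h1 := norm_trace_conjTranspose_mul_sq_le (P * V) W
  have h2 := norm_trace_conjTranspose_mul_sq_le V ((1 - P) * W)
  rw [e P V hP hPP, hW] at h1
  rw [e _ W hQ hQQ, hV] at h2
  -- The overlap splits along P and 1 - P, each part being controlled by one error term. The factor
  -- 2 is (a+b)² ≤ 2(a²+b²).
  have h3 : (Vᴴ * W).trace = ((P * V)ᴴ * W).trace + (Vᴴ * ((1 - P) * W)).trace := by
    rw [← trace_add, conjTranspose_mul, hP.eq, Matrix.sub_mul, Matrix.one_mul, Matrix.mul_sub,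
      Matrix.mul_assoc, add_sub_cancel]
  have h4 := norm_add_le ((P * V)ᴴ * W).trace (Vᴴ * ((1 - P) * W)).trace
  rw [← h3] at h4
  have h5 := pow_le_pow_left₀ (norm_nonneg _) h4 2
  simp only [Complex.one_re, one_mul, mul_one] at h1 h2
  nlinarith [sq_nonneg (‖((P * V)ᴴ * W).trace‖ - ‖(Vᴴ * ((1 - P) * W)).trace‖)]

lemma cfc_sqrt_mul_self {A : Matrix d d ℂ} (hA : A.PosSemidef) :
    cfc Real.sqrt A * cfc Real.sqrt A = A := by
  rw [← cfc_mul _ _ A (continuousOn_spectrum _ _) (continuousOn_spectrum _ _)]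
  nth_rw 2 [← cfc_id' ℝ A hA.1.isSelfAdjoint]
  refine cfc_congr fun x hx => Real.mul_self_sqrt ?_
  rw [hA.1.spectrum_real_eq_range_eigenvalues] at hx
  obtain ⟨i, rfl⟩ := hx
  exact hA.eigenvalues_nonneg i

/-- The trace norm is attained on a partial isometry. -/
lemma exists_partialIsometry_trace_eq (T : Matrix d d ℂ) :
    ∃ K : Matrix d d ℂ, (K * T).trace = traceNorm T ∧ (K * Kᴴ) * (K * Kᴴ) = K * Kᴴ := by
  set N := Tᴴ * T with hN
  have hNp : N.PosSemidef := posSemidef_conjTranspose_mul_self T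
  have hNs : IsSelfAdjoint N := hNp.1.isSelfAdjoint
  -- Since 0⁻¹ = 0, this is the pseudo-inverse of √(T†T), and G T† is the adjoint of the polar
  -- partial isometry of T.
  set G := cfc (fun x : ℝ => (Real.sqrt x)⁻¹) N with hG
  have hGs : Gᴴ = G := (cfc_predicate (fun x : ℝ => (Real.sqrt x)⁻¹) N : IsSelfAdjoint G)
  have h1 : G * N = cfc Real.sqrt N := by
    have : G * N = G * cfc (fun x : ℝ => x) N := by rw [cfc_id' ℝ N hNs]
    rw [this, hG, ← cfc_mul _ _ N (continuousOn_spectrum _ _) (continuousOn_spectrum _ _)]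
    refine cfc_congr fun x hx => ?_
    rw [inv_mul_eq_div, Real.div_sqrt]
  have h2 : cfc Real.sqrt N * G = posProj N := by
    rw [posProj, hG, ← cfc_mul _ _ N (continuousOn_spectrum _ _) (continuousOn_spectrum _ _)]
    refine cfc_congr fun x hx => ?_
    split_ifs with h
    · exact mul_inv_cancel₀ (Real.sqrt_pos.mpr h).ne'
    · simp [Real.sqrt_eq_zero_of_nonpos (not_lt.mp h)]
  have h3 : (G * Tᴴ) * (G * Tᴴ)ᴴ = posProj N := by
    rw [conjTranspose_mul, conjTranspose_conjTranspose, hGs, ← h2, ← h1, hN]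
    simp only [mul_assoc]
  refine ⟨G * Tᴴ, ?_, by rw [h3, posProj_mul_self]⟩
  rw [mul_assoc, ← hN, h1, traceNorm, trace_cfc hNp.1, ← Complex.ofReal_sum, Complex.ofReal_re]

/-- Purifications attaining the root-fidelity (Uhlmann). -/
lemma exists_purifications {ρ σ : Matrix d d ℂ} (hρ : ρ.PosSemidef) (hσ : σ.PosSemidef) :
    ∃ V W : Matrix d (d ⊕ d) ℂ, V * Vᴴ = ρ ∧ W * Wᴴ = σ ∧ (Vᴴ * W).trace = rootFidelity ρ σ := by
  obtain ⟨K, hK, hE⟩ := exists_partialIsometry_trace_eq (cfc Real.sqrt ρ * cfc Real.sqrt σ)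
  set r := cfc Real.sqrt ρ with hr
  set s := cfc Real.sqrt σ with hs
  have hrs : rᴴ = r := (cfc_predicate Real.sqrt ρ : IsSelfAdjoint r)
  have hss : sᴴ = s := (cfc_predicate Real.sqrt σ : IsSelfAdjoint s)
  set E := K * Kᴴ with hEd
  have hEs : Eᴴ = E := (isHermitian_mul_conjTranspose_self K)
  -- The second block of columns supplies the part of σ lost because K is only a partial isometry;
  -- it meets the zero block of V and so leaves the overlap alone.
  refine ⟨fromCols r 0, fromCols (s * K) (s * (1 - E)), ?_, ?_, ?_⟩
  · rw [conjTranspose_fromCols_eq_fromRows_conjTranspose, fromCols_mul_fromRows, hrs,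
      cfc_sqrt_mul_self hρ]; simp
  · rw [conjTranspose_fromCols_eq_fromRows_conjTranspose, fromCols_mul_fromRows,
      conjTranspose_mul, conjTranspose_mul, conjTranspose_sub, hEs, hss, conjTranspose_one]
    have : s * K * (Kᴴ * s) + s * (1 - E) * ((1 - E) * s) = s * (E + (1 - E) * (1 - E)) * s := by
      rw [hEd]; noncomm_ring
    rw [this, mul_sub, sub_mul, sub_mul, hE]
    simp [cfc_sqrt_mul_self hσ, hs]
  · rw [conjTranspose_fromCols_eq_fromRows_conjTranspose, fromRows_mul_fromCols, hrs]
    have : (fromBlocks (r * (s * K)) (r * (s * (1 - E))) ((0 : Matrix d d ℂ)ᴴ * (s * K))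
        ((0 : Matrix d d ℂ)ᴴ * (s * (1 - E)))).trace = (r * (s * K)).trace := by
      simp [trace, Fintype.sum_sum_type]
    rw [this]
    rw [rootFidelity, ← hr, ← hs, ← hK, ← mul_assoc, trace_mul_comm K]

end Fidelity

/-! ### Entropy of block-diagonal states -/

open Matrix

section Block

variable {d o : Type*} [Fintype d] [DecidableEq d] [Fintype o] [DecidableEq o]

/-- Expressed through the characteristic polynomial, the trace depends only on the multiset of
eigenvalues, so block-diagonal matrices need no matching of eigenbases. -/
lemma trace_cfc_re_eq_sum_roots {X : Matrix d d ℂ} (hX : X.IsHermitian) (f : ℝ → ℝ) :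
    (cfc f X).trace.re = (X.charpoly.roots.map fun z => f z.re).sum := by
  rw [trace_cfc hX, hX.roots_charpoly_eq_eigenvalues]
  simp

lemma charpoly_blockDiagonal (M : o → Matrix d d ℂ) :
    (blockDiagonal M).charpoly = ∏ k, (M k).charpoly := by
  have : (blockDiagonal M).charmatrix = blockDiagonal fun k => (M k).charmatrix := by
    ext ⟨i, k⟩ ⟨j, l⟩
    by_cases h : k = l
    · subst h; simp [charmatrix_apply, blockDiagonal_apply, diagonal_apply]
    · simp [blockDiagonal_apply, h]
  simp only [Matrix.charpoly, this, det_blockDiagonal]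

omit [Fintype d] [DecidableEq d] [Fintype o] in
lemma isHermitian_blockDiagonal {M : o → Matrix d d ℂ} (hM : ∀ k, (M k).IsHermitian) :
    (blockDiagonal M).IsHermitian := by
  rw [IsHermitian, blockDiagonal_conjTranspose]
  exact congrArg _ (funext hM)

lemma vonNeumannEntropy_blockDiagonal {M : o → Matrix d d ℂ} (hM : ∀ k, (M k).IsHermitian) :
    vonNeumannEntropy (blockDiagonal M) = (∑ k, entropyNat (M k)) / Real.log 2 := by
  rw [vonNeumannEntropy, trace_cfc_re_eq_sum_roots (isHermitian_blockDiagonal hM),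
    charpoly_blockDiagonal, Polynomial.roots_prod _ _
      (Finset.prod_ne_zero_iff.mpr fun k _ => (charpoly_monic _).ne_zero)]
  congr 1
  simp only [entropyNat, trace_cfc_re_eq_sum_roots (hM _)]
  rw [Multiset.map_bind, Multiset.sum_bind]
  rfl

end Block

/-! ### Tensor products of finite families -/

section Tensor

variable {ι d k l : Type*} [Fintype ι] [DecidableEq ι] [Fintype d] [Fintype k] [Fintype l]

/-- The tensor product of a finite family of matrices. -/
def tensor (V : ι → Matrix d k ℂ) : Matrix (ι → d) (ι → k) ℂ :=
  Matrix.of fun x y => ∏ i, V i (x i) (y i)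

omit [DecidableEq ι] [Fintype d] [Fintype k] in
lemma conjTranspose_tensor (V : ι → Matrix d k ℂ) : (tensor V)ᴴ = tensor fun i => (V i)ᴴ := by
  ext x y
  simp [tensor]

omit [Fintype d] [Fintype l] in
lemma tensor_mul_tensor (V : ι → Matrix d k ℂ) (W : ι → Matrix k l ℂ) :
    tensor V * tensor W = tensor fun i => V i * W i := by
  ext x y
  simp only [tensor, of_apply, mul_apply, ← Finset.prod_mul_distrib]
  rw [Finset.prod_univ_sum, Fintype.piFinset_univ]

lemma trace_tensor (V : ι → Matrix d d ℂ) : (tensor V).trace = ∏ i, (V i).trace := by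
  simp only [trace, diag_apply]
  rw [Finset.prod_univ_sum, Fintype.piFinset_univ]
  rfl

omit [DecidableEq ι] [Fintype d] [Fintype k] in
lemma tensor_smul (c : ι → ℂ) (V : ι → Matrix d k ℂ) :
    (tensor fun i => c i • V i) = (∏ i, c i) • tensor V := by
  ext x y
  simp [tensor, Finset.prod_mul_distrib]

lemma posSemidef_tensor [DecidableEq d] {V : ι → Matrix d d ℂ} (hV : ∀ i, (V i).PosSemidef) :
    (tensor V).PosSemidef := by
  have : ∀ i, ∃ C : Matrix d d ℂ, V i = C * Cᴴ := fun i => by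
    open scoped MatrixOrder in
    obtain ⟨C, hC⟩ := CStarAlgebra.nonneg_iff_eq_mul_star_self.mp (hV i).nonneg
    exact ⟨C, hC⟩
  choose C hC using this
  have e : tensor V = tensor C * (tensor C)ᴴ := by
    rw [conjTranspose_tensor, tensor_mul_tensor]; exact congrArg _ (funext hC)
  rw [e]
  exact posSemidef_self_mul_conjTranspose _

end Tensor

/-! ### Eve's operators and the acceptance statistics -/

namespace Round

variable {dA dB dE : Type*} [Fintype dA] [DecidableEq dA] [Fintype dB] [DecidableEq dB]
  [Fintype dE] [DecidableEq dE] (R : Round dA dB dE)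

lemma posSemidef_eveOp (a b : Bool) : (R.eveOp a b).PosSemidef := by
  obtain ⟨C, hC⟩ : ∃ C : Matrix dA dA ℂ, R.A₀.effect a = Cᴴ * C := by
    open scoped MatrixOrder in
    exact CStarAlgebra.nonneg_iff_eq_star_mul_self.mp (R.A₀.posSemidef a).nonneg
  obtain ⟨D, hD⟩ : ∃ D : Matrix dB dB ℂ, R.B₀.effect b = Dᴴ * D := by
    open scoped MatrixOrder in
    exact CStarAlgebra.nonneg_iff_eq_star_mul_self.mp (R.B₀.posSemidef b).nonneg
  -- Kraus operators: row p of C, tensored with row q of D and the identity on Eve's system. The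
  -- `calc` below only reorders the summations.
  let T : dA → dB → Matrix dE (dA × dB × dE) ℂ := fun p q =>
    Matrix.of fun e x => C p x.1 * D q x.2.1 * (1 : Matrix dE dE ℂ) e x.2.2
  have h : R.eveOp a b = ∑ p, ∑ q, T p q * R.state * (T p q)ᴴ := by
    ext e e'
    simp only [eveOp, of_apply, Matrix.sum_apply, mul_apply, Fintype.sum_prod_type,
      kroneckerMap_apply, conjTranspose_apply, T, one_apply, mul_ite, mul_one, mul_zero, ite_mul,
      zero_mul, Finset.sum_ite_eq, Finset.mem_univ, if_true, hC, hD, apply_ite star, star_zero,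
      star_mul']
    simp only [Finset.sum_mul, Finset.mul_sum]
    let F : dA → dB → dA → dB → dB → dA → ℂ := fun i' j' i j q p =>
      star (C p i') * C p i * (star (D q j') * D q j) * R.state (i, j, e) (i', j', e')
    calc _ = ∑ t : dA × dB × dA × dB × dB × dA, F t.1 t.2.1 t.2.2.1 t.2.2.2.1 t.2.2.2.2.1
            t.2.2.2.2.2 := by simp only [Fintype.sum_prod_type, F]
      _ = ∑ t : dA × dB × dA × dB × dA × dB, F t.2.2.1 t.2.2.2.1 t.2.2.2.2.1 t.2.2.2.2.2 t.2.1
            t.1 :=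
          Fintype.sum_equiv
            { toFun := fun t => (t.2.2.2.2.2, t.2.2.2.2.1, t.1, t.2.1, t.2.2.1, t.2.2.2.1)
              invFun := fun t => (t.2.2.1, t.2.2.2.1, t.2.2.2.2.1, t.2.2.2.2.2, t.2.1, t.1)
              left_inv := fun _ => rfl
              right_inv := fun _ => rfl } _ _ fun _ => rfl
      _ = _ := by
          simp only [Fintype.sum_prod_type, F]
          repeat refine Finset.sum_congr rfl fun _ _ => ?_
          ring
  rw [h]
  exact posSemidef_sum _ fun p _ => posSemidef_sum _ fun q _ =>
    R.isDensity.posSemidef.mul_mul_conjTranspose_same _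

lemma eveOp_eq_smul {a b : Bool} (h : R.prob a b ≠ 0) :
    R.eveOp a b = (R.prob a b : ℂ) • R.eveState a b := by
  rw [eveState, smul_smul, mul_inv_cancel₀ (by exact_mod_cast h), one_smul]

lemma trace_eveOp (a b : Bool) : (R.eveOp a b).trace = R.prob a b := by
  have := (Complex.nonneg_iff.mp (R.posSemidef_eveOp a b).trace_nonneg).2
  exact Complex.ext (by simp [prob]) (by simpa using this.symm)

lemma prob_nonneg (a b : Bool) : 0 ≤ R.prob a b :=
  (Complex.nonneg_iff.mp (R.posSemidef_eveOp a b).trace_nonneg).1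

lemma posSemidef_eveState (a b : Bool) : (R.eveState a b).PosSemidef := by
  rw [eveState]
  exact (R.posSemidef_eveOp a b).smul (by exact_mod_cast inv_nonneg.mpr (R.prob_nonneg a b))

lemma trace_eveState {a b : Bool} (h : R.prob a b ≠ 0) : (R.eveState a b).trace = 1 := by
  rw [eveState, trace_smul, trace_eveOp, smul_eq_mul, inv_mul_cancel₀ (by exact_mod_cast h)]

lemma eveBlock_eq_tensor {n : ℕ} (a b : Fin n → Bool) :
    R.eveBlock a b = tensor fun i => R.eveOp (a i) (b i) := rfl

/-- The values c, c', m determine both output strings, so a single term of the double sum survives.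
-/
lemma acceptedOp_eq {n : ℕ} (c c' : Bool) (m : Fin n → Bool) :
    R.acceptedOp c c' m =
      (1 / 2 : ℂ) • tensor fun i => R.eveOp (xor (m i) c) (xor (m i) c') := by
  have h : ∀ a b : Fin n → Bool, ((∀ i, m i = xor (a i) c) ∧ (∀ i, xor (b i) (m i) = c')) ↔
      (a = (fun i => xor (m i) c) ∧ b = fun i => xor (m i) c') := by
    intro a b
    simp only [funext_iff]
    refine and_congr (forall_congr' fun i => ?_) (forall_congr' fun i => ?_)
    · cases m i <;> cases a i <;> cases c <;> decide
    · cases m i <;> cases b i <;> cases c' <;> decide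
  simp only [acceptedOp, h, eveBlock_eq_tensor]
  rw [Finset.sum_eq_single (fun i => xor (m i) c), Finset.sum_eq_single (fun i => xor (m i) c')]
  · simp
  · intro b _ hb; simp [hb]
  · simp
  · intro a _ ha; simp [ha]
  · simp

lemma posSemidef_acceptedOp {n : ℕ} (c c' : Bool) (m : Fin n → Bool) :
    (R.acceptedOp c c' m).PosSemidef := by
  rw [acceptedOp_eq]
  exact (posSemidef_tensor fun i => R.posSemidef_eveOp _ _).smul
    (by rw [Complex.nonneg_iff]; norm_num)

lemma acceptProb_nonneg (n : ℕ) : 0 ≤ R.acceptProb n :=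
  Finset.sum_nonneg fun c _ => Finset.sum_nonneg fun c' _ => Finset.sum_nonneg fun m _ =>
    (Complex.nonneg_iff.mp (R.posSemidef_acceptedOp c c' m).trace_nonneg).1

lemma posSemidef_condOp {n : ℕ} (c c' : Bool) (m : Fin n → Bool) :
    (R.condOp c c' m).PosSemidef := by
  rw [condOp]
  exact (R.posSemidef_acceptedOp c c' m).smul
    (by exact_mod_cast inv_nonneg.mpr (R.acceptProb_nonneg n))

variable {R} {ε : ℝ}

lemma Symmetrised.prob_eq (h : R.Symmetrised ε) (a b : Bool) :
    R.prob a b = if a = b then (1 - ε) / 2 else ε / 2 := by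
  cases a <;> cases b <;> simp [h.prob_ff, h.prob_tt, h.prob_ft, h.prob_tf]

lemma Symmetrised.nonneg (h : R.Symmetrised ε) : 0 ≤ ε := by
  have := R.prob_nonneg false true
  rw [h.prob_ft] at this
  linarith

lemma Symmetrised.trace_acceptedOp (h : R.Symmetrised ε) {n : ℕ} (c c' : Bool)
    (m : Fin n → Bool) :
    (R.acceptedOp c c' m).trace.re = (if c = c' then (1 - ε) / 2 else ε / 2) ^ n / 2 := by
  have e : ∀ i, (R.eveOp (xor (m i) c) (xor (m i) c')).trace =
      ((if c = c' then (1 - ε) / 2 else ε / 2 : ℝ) : ℂ) := by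
    intro i
    rw [trace_eveOp, h.prob_eq]
    simp
  generalize (if c = c' then (1 - ε) / 2 else ε / 2) = p at e ⊢
  rw [acceptedOp_eq, trace_smul, trace_tensor]
  simp only [e, Finset.prod_const, Finset.card_univ, Fintype.card_fin, smul_eq_mul]
  rw [← Complex.ofReal_pow, Complex.re_mul_ofReal]
  norm_num
  ring

lemma Symmetrised.sum_trace_acceptedOp (h : R.Symmetrised ε) (n : ℕ) (c c' : Bool) :
    ∑ m : Fin n → Bool, (R.acceptedOp c c' m).trace.re =
      (if c = c' then 1 - ε else ε) ^ n / 2 := by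
  simp only [h.trace_acceptedOp, Finset.sum_const, Finset.card_univ, Fintype.card_fun,
    Fintype.card_bool, Fintype.card_fin, nsmul_eq_mul]
  split_ifs <;> simp only [div_pow] <;> push_cast <;> field_simp

lemma Symmetrised.acceptProb_eq (h : R.Symmetrised ε) (n : ℕ) :
    R.acceptProb n = (1 - ε) ^ n + ε ^ n := by
  simp only [acceptProb, h.sum_trace_acceptedOp, Fintype.sum_bool]
  simp
  ring

lemma Symmetrised.probCC_eq (h : R.Symmetrised ε) (n : ℕ) (c c' : Bool) :
    R.probCC n (c, c') =
      (if c = c' then 1 - ε else ε) ^ n / ((1 - ε) ^ n + ε ^ n) / 2 := by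
  have e : ∀ m : Fin n → Bool, (R.condOp c c' m).trace.re =
      (R.acceptProb n)⁻¹ * (R.acceptedOp c c' m).trace.re := fun m => by
    rw [condOp, trace_smul, smul_eq_mul, ← Complex.ofReal_inv, Complex.re_ofReal_mul]
  simp only [probCC, e]
  rw [← Finset.mul_sum, h.sum_trace_acceptedOp, h.acceptProb_eq]
  ring

end Round

/-! ### Eve's and Bob's conditional entropies -/

open Matrix

namespace Round

variable {dA dB dE : Type*} [Fintype dA] [DecidableEq dA] [Fintype dB] [DecidableEq dB]
  [Fintype dE] [DecidableEq dE] {R : Round dA dB dE} {ε : ℝ}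

lemma Symmetrised.condOp_self_eq (h : R.Symmetrised ε) (hε : ε < 1 / 2) {n : ℕ} (c : Bool)
    (m : Fin n → Bool) :
    R.condOp c c m = (((1 - ε) ^ n / (2 ^ n * 2 * ((1 - ε) ^ n + ε ^ n)) : ℝ) : ℂ) •
      tensor fun i => R.eveState (xor (m i) c) (xor (m i) c) := by
  have e : ∀ b, R.eveOp b b = (((1 - ε) / 2 : ℝ) : ℂ) • R.eveState b b := by
    intro b
    have hb : R.prob b b = (1 - ε) / 2 := by rw [h.prob_eq]; simp
    rw [R.eveOp_eq_smul (by rw [hb]; linarith), hb]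
  rw [condOp, acceptedOp_eq]
  simp only [e]
  rw [tensor_smul, smul_smul, smul_smul, h.acceptProb_eq]
  congr 1
  simp only [Finset.prod_const, Finset.card_univ, Fintype.card_fin]
  push_cast
  rw [div_pow]
  simp only [div_eq_mul_inv, mul_inv]
  ring

lemma Symmetrised.le_entropy_block (h : R.Symmetrised ε) (hε : ε < 1 / 2) {n : ℕ}
    (m : Fin n → Bool) :
    (1 - ε) ^ n / (2 ^ n * 4 * ((1 - ε) ^ n + ε ^ n)) *
        (rootFidelity (R.eveState false false) (R.eveState true true) ^ 2) ^ n ≤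
      entropyNat (∑ c', R.condOp false c' m) + entropyNat (∑ c', R.condOp true c' m) -
        entropyNat (∑ c, ∑ c', R.condOp c c' m) := by
  set F := rootFidelity (R.eveState false false) (R.eveState true true) with hF
  obtain ⟨V, W, hV, hW, hVW⟩ := exists_purifications (R.posSemidef_eveState false false)
    (R.posSemidef_eveState true true)
  let Q : Bool → Matrix dE (dE ⊕ dE) ℂ := fun b => if b then W else V
  have hQ : ∀ b, Q b * (Q b)ᴴ = R.eveState b b := by rintro (_ | _) <;> simp [Q, hV, hW]
  have htr : ∀ b, (R.eveState b b).trace = 1 := fun b =>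
    R.trace_eveState (by rw [h.prob_eq, if_pos rfl]; linarith)
  -- A message bit 1 exchanges V and W, which conjugates the overlap; F is real, so every factor
  -- contributes F.
  have hover : ∀ b, ((Q (xor b false))ᴴ * Q (xor b true)).trace = (F : ℂ) := by
    have hWV : (Wᴴ * V).trace = (F : ℂ) := by
      have := congrArg star hVW
      rw [← trace_conjTranspose, conjTranspose_mul, conjTranspose_conjTranspose] at this
      rw [this, hF]; simp
    rintro (_ | _)
    · simpa [Q] using hVW
    · simpa [Q] using hWV
  let T : Bool → Matrix (Fin n → dE) (Fin n → dE ⊕ dE) ℂ := fun c =>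
    tensor fun i => Q (xor (m i) c)
  have hT : ∀ c, T c * (T c)ᴴ = tensor fun i => R.eveState (xor (m i) c) (xor (m i) c) := by
    intro c
    simp only [T, conjTranspose_tensor, tensor_mul_tensor, hQ]
  have hT1 : ∀ c, (T c * (T c)ᴴ).trace = 1 := by
    intro c
    rw [hT, trace_tensor]; simp [htr]
  set A := ∑ c', R.condOp false c' m with hA
  set B := ∑ c', R.condOp true c' m with hB
  have hAp : A.PosSemidef := posSemidef_sum _ fun c' _ => R.posSemidef_condOp _ _ _
  have hBp : B.PosSemidef := posSemidef_sum _ fun c' _ => R.posSemidef_condOp _ _ _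
  have hAB : ∑ c, ∑ c', R.condOp c c' m = A + B := by
    rw [Fintype.sum_bool, add_comm]
  set P := posProj (B - A) with hP
  have hPp : P.PosSemidef := posSemidef_posProj _
  have hPP : P * P = P := posProj_mul_self _
  have hQp : (1 - P).PosSemidef := by
    have e : 1 - P = (1 - P) * (1 - P)ᴴ := by
      rw [conjTranspose_sub, hPp.1.eq, conjTranspose_one, mul_sub, sub_mul, sub_mul, hPP]; simp
    rw [e]
    exact posSemidef_self_mul_conjTranspose _
  have herr := norm_trace_sq_le_error hPp.1 hPP (hT1 false) (hT1 true)
  have hov : ‖((T false)ᴴ * T true).trace‖ ^ 2 = (F ^ 2) ^ n := by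
    simp only [T, conjTranspose_tensor, tensor_mul_tensor, trace_tensor, hover, Finset.prod_const,
      Finset.card_univ, Fintype.card_fin, norm_pow, Complex.norm_real, Real.norm_eq_abs]
    rw [← pow_mul, mul_comm, pow_mul, sq_abs]
  rw [hov, hT, hT] at herr
  rw [hAB]
  refine le_trans ?_ (error_le_entropy hAp hBp)
  rw [← hP]
  set s := (1 - ε) ^ n / (2 ^ n * 2 * ((1 - ε) ^ n + ε ^ n)) with hs
  have hs0 : 0 ≤ s := by
    have := h.nonneg
    have : 0 < 1 - ε := by linarith
    positivity
  -- The component with C' ≠ C only adds to Eve's error and is dropped; s is the weight of the one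
  -- with C' = C.
  have h1 : s * ((tensor fun i => R.eveState (xor (m i) false) (xor (m i) false)) * P).trace.re ≤
      (A * P).trace.re := by
    have : A = R.condOp false true m + R.condOp false false m := by rw [hA, Fintype.sum_bool]
    rw [this, h.condOp_self_eq hε, add_mul, trace_add, Complex.add_re, smul_mul_assoc, trace_smul,
      smul_eq_mul, Complex.re_ofReal_mul]
    exact le_add_of_nonneg_left (trace_mul_re_nonneg (R.posSemidef_condOp _ _ _) hPp)
  have h2 : s * ((tensor fun i => R.eveState (xor (m i) true) (xor (m i) true)) *
      (1 - P)).trace.re ≤ (B * (1 - P)).trace.re := by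
    have : B = R.condOp true true m + R.condOp true false m := by rw [hB, Fintype.sum_bool]
    rw [this, h.condOp_self_eq hε, add_mul, trace_add, Complex.add_re, smul_mul_assoc, trace_smul,
      smul_eq_mul, Complex.re_ofReal_mul]
    exact le_add_of_nonneg_right (trace_mul_re_nonneg (R.posSemidef_condOp _ _ _) hQp)
  have h3 := mul_le_mul_of_nonneg_left herr hs0
  have h4 : (1 - ε) ^ n / (2 ^ n * 4 * ((1 - ε) ^ n + ε ^ n)) = s / 2 := by
    rw [hs, div_div]; congr 1; ring
  rw [h4]
  linarith

lemma Symmetrised.le_entropyEve (h : R.Symmetrised ε) (hε : ε < 1 / 2) (n : ℕ) :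
    (1 - ε) ^ n / (4 * ((1 - ε) ^ n + ε ^ n)) *
        (rootFidelity (R.eveState false false) (R.eveState true true) ^ 2) ^ n / Real.log 2 ≤
      R.entropyEve n := by
  have hC : ∀ (c : Bool) (m : Fin n → Bool), (∑ c', R.condOp c c' m).PosSemidef := fun c m =>
    posSemidef_sum _ fun c' _ => R.posSemidef_condOp c c' m
  have e1 : vonNeumannEntropy (R.stateCME n) =
      (∑ k : Bool × (Fin n → Bool), entropyNat (∑ c', R.condOp k.1 c' k.2)) / Real.log 2 :=
    vonNeumannEntropy_blockDiagonal fun k : Bool × (Fin n → Bool) => (hC k.1 k.2).1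
  have e2 : vonNeumannEntropy (R.stateME n) =
      (∑ m : Fin n → Bool, entropyNat (∑ c, ∑ c', R.condOp c c' m)) / Real.log 2 :=
    vonNeumannEntropy_blockDiagonal fun m => (posSemidef_sum _ fun c _ => hC c m).1
  rw [entropyEve, e1, e2, ← sub_div]
  refine div_le_div_of_nonneg_right ?_ (Real.log_nonneg one_le_two)
  have key := Finset.sum_le_sum fun (m : Fin n → Bool) (_ : m ∈ Finset.univ) =>
    h.le_entropy_block hε m
  rw [Finset.sum_sub_distrib, Finset.sum_add_distrib, Finset.sum_const, Finset.card_univ,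
    Fintype.card_fun, Fintype.card_bool, Fintype.card_fin, nsmul_eq_mul, ← mul_assoc] at key
  have hconst : ((2 ^ n : ℕ) : ℝ) * ((1 - ε) ^ n / (2 ^ n * 4 * ((1 - ε) ^ n + ε ^ n))) =
      (1 - ε) ^ n / (4 * ((1 - ε) ^ n + ε ^ n)) := by
    rw [Nat.cast_pow, Nat.cast_ofNat, mul_assoc (2 ^ n : ℝ), mul_div_assoc',
      mul_div_mul_left _ _ (by positivity)]
  have hsum : ∑ k : Bool × (Fin n → Bool), entropyNat (∑ c', R.condOp k.1 c' k.2) =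
      ∑ m : Fin n → Bool, entropyNat (∑ c', R.condOp false c' m) +
        ∑ m : Fin n → Bool, entropyNat (∑ c', R.condOp true c' m) := by
    rw [Fintype.sum_prod_type, Fintype.sum_bool, add_comm]
  rw [hconst] at key
  rw [hsum]
  exact key

lemma Symmetrised.entropyBob_eq (h : R.Symmetrised ε) (hε : ε < 1 / 2) (n : ℕ) :
    R.entropyBob n = (Real.negMulLog ((1 - ε) ^ n / ((1 - ε) ^ n + ε ^ n)) +
      Real.negMulLog (ε ^ n / ((1 - ε) ^ n + ε ^ n))) / Real.log 2 := by
  have h0 := h.nonneg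
  have h1 : 0 < 1 - ε := by linarith
  have hq : (0 : ℝ) < (1 - ε) ^ n + ε ^ n := by positivity
  have hsum : (1 - ε) ^ n / ((1 - ε) ^ n + ε ^ n) + ε ^ n / ((1 - ε) ^ n + ε ^ n) = 1 := by
    rw [← add_div, div_self hq.ne']
  -- Since C' is uniform, the joint probabilities are halves of those of the event C = C' and its
  -- complement; the contributions of the factor 1/2 cancel the entropy of C'.
  have hhalf : ∀ x : ℝ, Real.negMulLog (x / 2) =
      1 / 2 * Real.negMulLog x + x * Real.negMulLog (1 / 2) := fun x => by
    rw [div_eq_mul_one_div, Real.negMulLog_mul]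
  rw [entropyBob, shannonEntropy, shannonEntropy, ← sub_div]
  congr 1
  simp only [Fintype.sum_prod_type, Fintype.sum_bool, h.probCC_eq, if_true, Bool.false_eq_true,
    Bool.true_eq_false, if_false]
  have hs1 : (1 - ε) ^ n / ((1 - ε) ^ n + ε ^ n) / 2 + ε ^ n / ((1 - ε) ^ n + ε ^ n) / 2 =
      1 / 2 := by rw [← add_div, hsum]
  rw [add_comm (ε ^ n / _ / 2), hs1, hhalf ((1 - ε) ^ n / _), hhalf (ε ^ n / _)]
  linear_combination 2 * Real.negMulLog (1 / 2) * hsum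

end Round

/-! ### Scalar asymptotics -/

lemma negMulLog_le_one_sub {y : ℝ} (hy : 0 < y) : Real.negMulLog y ≤ 1 - y := by
  have := Real.one_sub_inv_le_log_of_pos hy
  have := mul_le_mul_of_nonneg_left this hy.le
  rw [mul_sub, mul_inv_cancel₀ hy.ne'] at this
  rw [Real.negMulLog]
  linarith

lemma binEntropy_odds_le {x : ℝ} (hx : 0 ≤ x) (hx1 : x ≤ 1) {n : ℕ} (hn : n ≠ 0) :
    Real.negMulLog (1 / (1 + x ^ n)) + Real.negMulLog (x ^ n / (1 + x ^ n)) ≤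
      x ^ n * (n * Real.log x⁻¹ + 2) := by
  rcases hx.eq_or_lt with rfl | hx
  · simp [hn]
  have hp : 0 < x ^ n := pow_pos hx n
  have hp1 : x ^ n ≤ 1 := pow_le_one₀ hx.le hx1
  have hδ : x ^ n / (1 + x ^ n) ≤ x ^ n := div_le_self hp.le (by linarith)
  have h1 : Real.negMulLog (1 / (1 + x ^ n)) ≤ x ^ n := by
    refine (negMulLog_le_one_sub (by positivity)).trans (le_trans (le_of_eq ?_) hδ)
    field_simp
    ring
  have hL : 0 ≤ n * Real.log x⁻¹ := mul_nonneg (Nat.cast_nonneg n)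
    (Real.log_nonneg (one_le_inv_iff₀.mpr ⟨hx, hx1⟩))
  have h2 : Real.negMulLog (x ^ n / (1 + x ^ n)) ≤ x ^ n * (n * Real.log x⁻¹ + 1) := by
    -- Only this term carries the factor n: minus the logarithm of the error probability is n
    -- log(1/x) plus at most x^n ≤ 1.
    have e : Real.negMulLog (x ^ n / (1 + x ^ n)) =
        x ^ n / (1 + x ^ n) * (n * Real.log x⁻¹ + Real.log (1 + x ^ n)) := by
      rw [Real.negMulLog, Real.log_div hp.ne' (by positivity), Real.log_pow, Real.log_inv]
      ring
    rw [e]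
    have := Real.log_le_sub_one_of_pos (show 0 < 1 + x ^ n by positivity)
    exact mul_le_mul hδ (by linarith)
      (add_nonneg hL (Real.log_nonneg (by linarith))) hp.le
  linarith

lemma eventually_pow_mul_lt {x y : ℝ} (hx : 0 ≤ x) (hxy : x < y) (L : ℝ) :
    ∀ᶠ n : ℕ in Filter.atTop, x ^ n * (n * L + 2) < 1 / 8 * y ^ n := by
  have hy : 0 < y := hx.trans_lt hxy
  have h0 : 0 ≤ x / y := by positivity
  have h1 : x / y < 1 := (div_lt_one hy).mpr hxy
  have ht : Filter.Tendsto (fun n : ℕ => n * (x / y) ^ n * L + 2 * (x / y) ^ n) Filter.atTop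
      (nhds (0 * L + 2 * 0)) :=
    ((tendsto_self_mul_const_pow_of_lt_one h0 h1).mul_const L).add
      ((tendsto_pow_atTop_nhds_zero_of_lt_one h0 h1).const_mul 2)
  filter_upwards [ht.eventually_lt_const (show 0 * L + 2 * 0 < 1 / 8 by norm_num)] with n hn
  have := mul_lt_mul_of_pos_right hn (pow_pos hy n)
  refine lt_of_eq_of_lt ?_ this
  rw [div_pow]
  field_simp

end RepetitionCode

theorem theorem1 {dA dB dE : Type*} [Fintype dA] [DecidableEq dA] [Fintype dB] [DecidableEq dB]
    [Fintype dE] [DecidableEq dE] (R : RepetitionCode.Round dA dB dE) (ε : ℝ) (hε : ε < 1 / 2)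
    (hsymm : R.Symmetrised ε)
    (hF : ε / (1 - ε) <
      RepetitionCode.rootFidelity (R.eveState false false) (R.eveState true true) ^ 2) :
    ∀ᶠ n : ℕ in Filter.atTop, 0 < R.keyRate n := by
  have h0 := hsymm.nonneg
  have h1 : 0 < 1 - ε := by linarith
  have hx : 0 ≤ ε / (1 - ε) := by positivity
  have hx1 : ε / (1 - ε) ≤ 1 := (div_le_one h1).mpr (by linarith)
  filter_upwards [RepetitionCode.eventually_pow_mul_lt hx hF (Real.log (ε / (1 - ε))⁻¹),
    Filter.eventually_ne_atTop 0] with n hn hn0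
  have hp := pow_pos h1 n
  have hE := hsymm.le_entropyEve hε n
  have hB := RepetitionCode.binEntropy_odds_le hx hx1 hn0
  have e1 : (1 - ε) ^ n / ((1 - ε) ^ n + ε ^ n) = 1 / (1 + (ε / (1 - ε)) ^ n) := by
    rw [div_pow]; field_simp
  have e2 : ε ^ n / ((1 - ε) ^ n + ε ^ n) = (ε / (1 - ε)) ^ n / (1 + (ε / (1 - ε)) ^ n) := by
    rw [div_pow]; field_simp
  rw [RepetitionCode.Round.keyRate, sub_pos, hsymm.entropyBob_eq hε, e1, e2]
  refine lt_of_lt_of_le ?_ hE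
  refine div_lt_div_of_pos_right (hB.trans_lt (hn.trans_le ?_)) (Real.log_pos one_lt_two)
  refine mul_le_mul_of_nonneg_right ?_ (by positivity)
  -- As ε < 1 - ε, the accepted block has C' = C with probability at least 1/2, so the prefactor is
  -- at least 1/8.
  have hle : ε ^ n ≤ (1 - ε) ^ n := pow_le_pow_left₀ h0 (by linarith) n
  rw [div_le_div_iff₀ (by norm_num) (by positivity)]
  linarith
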